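/- Let $n\ge 2$, and identify $\mathbb C^n$ with $\mathbb R^{2n}$ with its Euclidean distance $d$ and Lebesgue measure. Let $\Omega\subset\mathbb C^n$ be a domain (a non-empty connected open set) and $E\subset\mathbb C^n$ a closed set such that 1. there exists $r>0$ such that $E_r:=\{z\in\mathbb C^n: d(z,E)\le r\}\subset\Omega$; 2. there exist a (non-empty) real affine subspace $H\subset\mathbb R^{2n}=\mathbb C^n$ of real codimension $\ge 3$ and a number $R>0$ such that $E\subset H_R:=\{z\in\mathbb C^n: d(z,H)<R\}$; 3. $\Omega\setminus E$ is connected. (Here $d(z,\emptyset)=\infty$.) For an open set $U\subset\mathbb C^n$ let $A^2(U)$ be the Bergman space of all holomorphic functions $f$ on $U$ with $\int_U|f|^2<\infty$. Then every $f\in A^2(\Omega\setminus E)$ extends to a function $F\in A^2(\Omega)$, i.e. $F=f$ on $\Omega\setminus E$. In other words, $A^2(\Omega\setminus E)$ coincides with $A^2(\Omega)$: the restriction map $F\mapsto F|_{\Omega\setminus E}$ is a bijection from $A^2(\Omega)$ onto $A^2(\Omega\setminus E)$. -/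

import Mathlib

open MeasureTheory

/-- `ℂⁿ` with its Hermitian norm; the distance is the Euclidean distance of `ℝ²ⁿ = ℂⁿ`, and `volume`
is Lebesgue measure. -/
abbrev CSpace (n : ℕ) : Type := EuclideanSpace ℂ (Fin n)

/-- `F` is an `L²` holomorphic function on the open set `U`: it is complex differentiable at the
points of `U` and `∫_U |F|² < ∞`. The values of `F` outside `U` play no role. -/
def IsL2Holomorphic {n : ℕ} (U : Set (CSpace n)) (F : CSpace n → ℂ) : Prop :=
  DifferentiableOn ℂ F U ∧ MemLp F 2 (volume.restrict U)

/-- The Bergman space `A²(U)` of an open set `U ⊆ ℂⁿ`: the complex vector space of all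
functions `f : U → ℂ` that are holomorphic and square integrable on `U`. -/
def bergmanSpace {n : ℕ} (U : Set (CSpace n)) : Submodule ℂ (U → ℂ) where
  carrier := {f | ∃ F : CSpace n → ℂ, IsL2Holomorphic U F ∧ (fun z : U => F z) = f}
  add_mem' := by
    rintro _ _ ⟨F, hF, rfl⟩ ⟨G, hG, rfl⟩
    exact ⟨F + G, ⟨hF.1.add hG.1, hF.2.add hG.2⟩, rfl⟩
  zero_mem' := ⟨0, ⟨differentiableOn_const 0, MemLp.zero⟩, rfl⟩
  smul_mem' := by
    rintro c _ ⟨F, hF, rfl⟩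
    exact ⟨c • F, ⟨hF.1.const_smul c, hF.2.const_smul c⟩, rfl⟩

/-- The restriction of a function on `Ω` to `Ω \ E`. -/
def restrictToDiff {n : ℕ} (Ω E : Set (CSpace n)) (f : Ω → ℂ) : (Ω \ E : Set (CSpace n)) → ℂ :=
  fun z => f ⟨z.1, z.2.1⟩

/-!
A Hartogs-type argument inside a tube. Let `χ` be a cutoff function equal to `1` near `E` and
supported in `Ω`, within a bounded distance of the real subspace `H`. Since `H` has codimension at
least `2`, some complex line `ℂ v` meets its direction only in `0`, so the lines parallel to `v`
meet the tube in sets of bounded size; the Cauchy transform `u` of `f ∂χ/∂v̄` along these lines then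
exists, and it solves `∂̄u = f ∂̄χ` in all directions because `f ∂̄χ` is `∂̄`-closed. Hence
`F = (1 - χ) f + u` is holomorphic on `Ω`. Since `H` has codimension at least `3`, some real linear
functional `ℓ ≠ 0` kills both the direction of `H` and `ℂ v`; thus `u` vanishes where `ℓ` is large,
and, being holomorphic off the support of `χ`, it vanishes on a component of the complement of that
support. This component meets `Ω \ E`, and there `F = f`, so `F = f` on the connected set `Ω \ E`.
On `E` one has `F = u`, whose `L^p` norm is controlled by Young's inequality on the lines.
-/

open Set Filter Topology Metric Module
open scoped ComplexConjugate Convolution ENNReal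

section Dbar

variable {X : Type*} [NormedAddCommGroup X] [NormedSpace ℂ X] {f g : X → ℂ} {v w z : X}

/-- The `∂̄` operator in the direction `w`: `dbar w g z` is the value at the parameter `ζ = 0` of
`∂/∂ζ̄ g (z + ζ • w)`. Conjugate-linear in `w`. -/
noncomputable def dbar (w : X) (g : X → ℂ) (z : X) : ℂ :=
  2⁻¹ * (fderiv ℝ g z w + Complex.I * fderiv ℝ g z (Complex.I • w))

theorem fderiv_smul_eq (g : X → ℂ) (c : ℂ) (w z : X) :
    fderiv ℝ g z (c • w) = c.re * fderiv ℝ g z w + c.im * fderiv ℝ g z (Complex.I • w) := by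
  have hc : c • w = c.re • w + c.im • (Complex.I • w) := by
    conv_lhs => rw [← Complex.re_add_im c]
    rw [add_smul, mul_smul]
    rfl
  rw [hc, map_add, map_smul, map_smul, Complex.real_smul, Complex.real_smul]

theorem dbar_smul (c : ℂ) (w : X) (g : X → ℂ) (z : X) :
    dbar (c • w) g z = conj c * dbar w g z := by
  have hconj : conj c = c.re - c.im * Complex.I := by simp [Complex.ext_iff]
  rw [dbar, dbar, smul_smul, fderiv_smul_eq g c, fderiv_smul_eq g (Complex.I * c), hconj,
    Complex.I_mul_re, Complex.I_mul_im]
  push_cast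
  linear_combination (c.im * fderiv ℝ g z (Complex.I • w) / 2) * Complex.I_sq

theorem dbar_eq_zero (hg : DifferentiableAt ℂ g z) (w : X) : dbar w g z = 0 := by
  rw [dbar, hg.fderiv_restrictScalars ℝ]
  simp only [ContinuousLinearMap.coe_restrictScalars', map_smul, smul_eq_mul]
  linear_combination (fderiv ℂ g z w / 2) * Complex.I_sq

theorem differentiableAt_complex_of_dbar_eq_zero (hg : DifferentiableAt ℝ g z)
    (h : ∀ w, dbar w g z = 0) : DifferentiableAt ℂ g z := by
  have hI (w : X) : fderiv ℝ g z (Complex.I • w) = Complex.I * fderiv ℝ g z w := by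
    have hw := h w
    rw [dbar] at hw
    linear_combination (-2 * Complex.I) * hw + fderiv ℝ g z (Complex.I • w) * Complex.I_sq
  let D : X →L[ℂ] ℂ :=
    { fderiv ℝ g z with
      map_smul' c w := by
        change fderiv ℝ g z (c • w) = c * fderiv ℝ g z w
        conv_rhs => rw [← Complex.re_add_im c]
        rw [fderiv_smul_eq, hI]
        ring }
  exact (differentiableAt_iff_restrictScalars ℝ hg).2 ⟨D, rfl⟩

theorem dbar_congr (h : f =ᶠ[𝓝 z] g) (w : X) : dbar w f z = dbar w g z := by
  rw [dbar, dbar, h.fderiv_eq]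

theorem dbar_add (hf : DifferentiableAt ℝ f z) (hg : DifferentiableAt ℝ g z) (w : X) :
    dbar w (f + g) z = dbar w f z + dbar w g z := by
  simp only [dbar, fderiv_add hf hg, add_apply]
  ring

theorem dbar_mul (hf : DifferentiableAt ℝ f z) (hg : DifferentiableAt ℝ g z) (w : X) :
    dbar w (f * g) z = f z * dbar w g z + dbar w f z * g z := by
  simp only [dbar, fderiv_mul hf hg, add_apply, smul_apply, smul_eq_mul]
  ring

theorem dbar_eq_zero_of_fderiv_eq_zero (h : fderiv ℝ g z = 0) (w : X) : dbar w g z = 0 := by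
  simp [dbar, h]

theorem norm_dbar_le (w : X) (g : X → ℂ) (z : X) : ‖dbar w g z‖ ≤ ‖w‖ * ‖fderiv ℝ g z‖ := by
  have h₁ := (fderiv ℝ g z).le_opNorm w
  have h₂ := (fderiv ℝ g z).le_opNorm (Complex.I • w)
  rw [norm_smul, Complex.norm_I, one_mul] at h₂
  have h₃ := norm_add_le (fderiv ℝ g z w) (Complex.I * fderiv ℝ g z (Complex.I • w))
  rw [norm_mul, Complex.norm_I, one_mul] at h₃
  rw [dbar, norm_mul, norm_inv, Complex.norm_ofNat]
  linarith

theorem support_dbar_subset (w : X) (g : X → ℂ) :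
    Function.support (dbar w g) ⊆ tsupport (fderiv ℝ g) := fun _ hz =>
  subset_tsupport _ fun h => hz (dbar_eq_zero_of_fderiv_eq_zero h w)

theorem contDiff_dbar {m n : WithTop ℕ∞} (hg : ContDiff ℝ n g) (hmn : m + 1 ≤ n) (w : X) :
    ContDiff ℝ m (dbar w g) :=
  have hf := hg.fderiv_right hmn
  contDiff_const.mul ((hf.clm_apply contDiff_const).add
    (contDiff_const.mul (hf.clm_apply contDiff_const)))

theorem dbar_comm (hg : ContDiff ℝ 2 g) (v w z : X) :
    dbar w (dbar v g) z = dbar v (dbar w g) z := by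
  have hD : DifferentiableAt ℝ (fderiv ℝ g) z :=
    (hg.fderiv_right (m := 1) (by norm_num)).differentiable one_ne_zero z
  have hsymm (a b : X) : fderiv ℝ (fderiv ℝ g) z a b = fderiv ℝ (fderiv ℝ g) z b a :=
    (hg.contDiffAt.isSymmSndFDerivAt (by simp)) a b
  have hfd (a b : X) :
      fderiv ℝ (dbar b g) z a = 2⁻¹ * (fderiv ℝ (fderiv ℝ g) z a b +
        Complex.I * fderiv ℝ (fderiv ℝ g) z a (Complex.I • b)) := by
    have hDb (b : X) := hD.hasFDerivAt.clm_apply (hasFDerivAt_const b z)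
    have h : fderiv ℝ (dbar b g) z = _ :=
      (((hDb b).add ((hDb (Complex.I • b)).const_mul Complex.I)).const_mul (2 : ℂ)⁻¹).fderiv
    simp [h, mul_add]
  rw [dbar, dbar, hfd, hfd, hfd, hfd, hsymm v w, hsymm v (Complex.I • w), hsymm (Complex.I • v) w,
    hsymm (Complex.I • v) (Complex.I • w)]
  ring

end Dbar

section CauchyPompeiu

theorem integral_Ioi_fderiv_smul {V F : Type*} [NormedAddCommGroup V] [NormedSpace ℝ V]
    [NormedAddCommGroup F] [NormedSpace ℝ F] [CompleteSpace F] {φ : V → F} (hφ : ContDiff ℝ 1 φ)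
    (hc : HasCompactSupport φ) {u : V} (hu : u ≠ 0) :
    ∫ r in Ioi (0 : ℝ), fderiv ℝ φ (r • u) u = -φ 0 := by
  have hray : HasCompactSupport fun r : ℝ => φ (r • u) :=
    hc.comp_isClosedEmbedding (isClosedEmbedding_smul_left hu)
  have hderiv (r : ℝ) : deriv (fun r : ℝ => φ (r • u)) r = fderiv ℝ φ (r • u) u := by
    have hsmul : HasDerivAt (fun r : ℝ => r • u) u r := by
      simpa using (hasDerivAt_id r).smul_const u
    exact ((hφ.differentiable one_ne_zero _).hasFDerivAt.comp_hasDerivAt r hsmul).deriv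
  have hsmooth : ContDiff ℝ 1 fun r : ℝ => φ (r • u) := by fun_prop
  simpa [hderiv] using hray.integral_Ioi_deriv_eq hsmooth 0

theorem intervalIntegral_fderiv_circleMap_zero {F : Type*} [NormedAddCommGroup F]
    [NormedSpace ℝ F] [CompleteSpace F] {φ : ℂ → F} (hφ : ContDiff ℝ 1 φ) (r : ℝ) :
    ∫ θ in (-Real.pi)..Real.pi,
      fderiv ℝ φ (circleMap 0 r θ) (circleMap 0 r θ * Complex.I) = 0 := by
  have hderiv (θ : ℝ) : HasDerivAt (fun θ => φ (circleMap 0 r θ))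
      (fderiv ℝ φ (circleMap 0 r θ) (circleMap 0 r θ * Complex.I)) θ :=
    (hφ.differentiable one_ne_zero _).hasFDerivAt.comp_hasDerivAt θ (hasDerivAt_circleMap 0 r θ)
  have hcont : Continuous fun θ =>
      fderiv ℝ φ (circleMap 0 r θ) (circleMap 0 r θ * Complex.I) := by
    have := hφ.continuous_fderiv one_ne_zero
    fun_prop
  rw [intervalIntegral.integral_eq_sub_of_hasDerivAt (fun θ _ => hderiv θ)
    (hcont.intervalIntegrable _ _)]
  simp [circleMap]

theorem integrableOn_polarCoord_target_fderiv {F : Type*} [NormedAddCommGroup F]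
    [NormedSpace ℝ F] {φ : ℂ → F} (hφ : ContDiff ℝ 1 φ) (hc : HasCompactSupport φ) {e : ℝ → ℂ}
    (he : Continuous e) :
    IntegrableOn (fun p => fderiv ℝ φ (circleMap 0 p.1 p.2) (e p.2)) polarCoord.target := by
  obtain ⟨ρ, -, hρ⟩ := (hc.fderiv ℝ).exists_pos_le_norm
  have hcont : Continuous fun p : ℝ × ℝ => fderiv ℝ φ (circleMap 0 p.1 p.2) (e p.2) := by
    have := hφ.continuous_fderiv one_ne_zero
    unfold circleMap
    fun_prop
  refine (hcont.continuousOn.integrableOn_compact (K := Icc 0 ρ ×ˢ Icc (-Real.pi) Real.pi)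
    (isCompact_Icc.prod isCompact_Icc)).of_forall_sdiff_eq_zero
    polarCoord.open_target.measurableSet fun p ⟨hp, hp'⟩ => ?_
  have hle : ρ ≤ ‖circleMap 0 p.1 p.2‖ := by
    by_contra! hlt
    rw [norm_circleMap_zero, abs_of_pos hp.1] at hlt
    exact hp' ⟨⟨hp.1.le, hlt.le⟩, Ioo_subset_Icc_self hp.2⟩
  rw [hρ _ hle, zero_apply]

variable {φ : ℂ → ℂ}

theorem integral_polarCoord_target_fderiv_radial (hφ : ContDiff ℝ 1 φ) (hc : HasCompactSupport φ) :
    ∫ p in polarCoord.target, fderiv ℝ φ (circleMap 0 p.1 p.2) (circleMap 0 1 p.2) =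
      -(2 * Real.pi * φ 0) := by
  have hint := integrableOn_polarCoord_target_fderiv hφ hc (continuous_circleMap 0 1)
  have hradial (θ : ℝ) :
      ∫ r in Ioi (0 : ℝ), fderiv ℝ φ (circleMap 0 r θ) (circleMap 0 1 θ) = -φ 0 := by
    have hmul (r : ℝ) : r • circleMap 0 1 θ = circleMap 0 r θ := by simp [circleMap]
    simpa only [hmul] using
      integral_Ioi_fderiv_smul hφ hc (circleMap_ne_center one_ne_zero : circleMap 0 1 θ ≠ 0)
  rw [polarCoord_target, Measure.volume_eq_prod, ← setIntegral_prod_swap,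
    setIntegral_prod]
  · simp only [Prod.fst_swap, Prod.snd_swap, hradial, setIntegral_const, Complex.real_smul,
      Real.volume_real_Ioo_of_le (neg_le_self Real.pi_pos.le)]
    push_cast
    ring
  · exact hint.swap

theorem integral_polarCoord_target_fderiv_angular (hφ : ContDiff ℝ 1 φ)
    (hc : HasCompactSupport φ) :
    ∫ p in polarCoord.target,
      fderiv ℝ φ (circleMap 0 p.1 p.2) (Complex.I * circleMap 0 1 p.2) = 0 := by
  have hint := integrableOn_polarCoord_target_fderiv hφ hc
    (e := fun θ => Complex.I * circleMap 0 1 θ) (by fun_prop)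
  rw [polarCoord_target, Measure.volume_eq_prod, setIntegral_prod _ hint]
  refine setIntegral_eq_zero_of_forall_eq_zero fun r (hr : 0 < r) => ?_
  have hmul (θ : ℝ) :
      circleMap 0 r θ * Complex.I = r • (Complex.I * circleMap 0 1 θ) := by
    simp [circleMap]
    ring
  have hcircle := intervalIntegral_fderiv_circleMap_zero hφ r
  simp only [hmul, map_smul, intervalIntegral.integral_smul, smul_eq_zero, hr.ne', false_or]
    at hcircle
  rw [← integral_Ioc_eq_integral_Ioo,
    ← intervalIntegral.integral_of_le (by linarith [Real.pi_pos]), hcircle]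

theorem cauchyPompeiu_zero (hφ : ContDiff ℝ 1 φ) (hc : HasCompactSupport φ) :
    ∫ ζ : ℂ, ζ⁻¹ * dbar 1 φ ζ = -(Real.pi * φ 0) := by
  have hpolar (p : ℝ × ℝ) (hp : p ∈ polarCoord.target) :
      p.1 • ((Complex.polarCoord.symm p)⁻¹ * dbar 1 φ (Complex.polarCoord.symm p)) =
        2⁻¹ * (fderiv ℝ φ (circleMap 0 p.1 p.2) (circleMap 0 1 p.2) +
          Complex.I * fderiv ℝ φ (circleMap 0 p.1 p.2) (Complex.I * circleMap 0 1 p.2)) := by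
    have hr : (p.1 : ℂ) ≠ 0 := Complex.ofReal_ne_zero.2 (ne_of_gt hp.1)
    have hsymm : Complex.polarCoord.symm p = circleMap 0 p.1 p.2 := by
      rw [Complex.polarCoord_symm_apply, circleMap_zero, Complex.exp_mul_I, Complex.ofReal_cos,
        Complex.ofReal_sin]
    have hmul : circleMap 0 p.1 p.2 = p.1 * circleMap 0 1 p.2 := by simp [circleMap]
    have hconj : conj (circleMap 0 1 p.2) = (circleMap 0 1 p.2)⁻¹ := by
      rw [Complex.inv_def, Complex.normSq_eq_norm_sq, norm_circleMap_zero]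
      simp
    have hdir := dbar_smul (circleMap 0 1 p.2) 1 φ (circleMap 0 p.1 p.2)
    rw [smul_eq_mul, mul_one, hconj] at hdir
    rw [hsymm, ← smul_eq_mul Complex.I (circleMap 0 1 p.2), ← dbar, hdir, Complex.real_smul,
      ← mul_assoc]
    nth_rewrite 1 [hmul]
    rw [mul_inv, mul_inv_cancel_left₀ hr]
  have hradial := integrableOn_polarCoord_target_fderiv hφ hc (continuous_circleMap 0 1)
  have hangular := integrableOn_polarCoord_target_fderiv hφ hc
    (e := fun θ => Complex.I * circleMap 0 1 θ) (by fun_prop)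
  rw [← Complex.integral_comp_polarCoord_symm,
    setIntegral_congr_fun polarCoord.open_target.measurableSet hpolar, integral_const_mul,
    integral_add hradial (hangular.const_mul _), integral_const_mul,
    integral_polarCoord_target_fderiv_radial hφ hc,
    integral_polarCoord_target_fderiv_angular hφ hc]
  ring

end CauchyPompeiu

section CauchyTransform

theorem locallyIntegrable_inv_complex : LocallyIntegrable fun ζ : ℂ => ζ⁻¹ := by
  refine locallyIntegrable_of_norm_le_rpow (C := 1) (α := 1) ?_ ?_ (.of_forall fun ζ => ?_)
    measurable_inv.aestronglyMeasurable
  · rw [Complex.finrank_real_complex]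
    norm_num
  · rw [Complex.finrank_real_complex]
    norm_num
  · rw [norm_inv, Real.rpow_neg_one, one_mul]

variable {X : Type*} [NormedAddCommGroup X] [NormedSpace ℂ X] {v w z : X}

/-- The solution operator of the equation `dbar v u = a`: the Cauchy transform of the restriction
of `a` to each complex line parallel to `v`. -/
noncomputable def cauchyTransform (v : X) (a : X → ℂ) (z : X) : ℂ :=
  (Real.pi : ℂ)⁻¹ * ∫ ζ : ℂ, ζ⁻¹ * a (z - ζ • v)

theorem dbar_one_comp_line {b : X → ℂ} (hb : Differentiable ℝ b) (v z : X) (ζ : ℂ) :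
    dbar 1 (fun ζ : ℂ => b (z - ζ • v)) ζ = -dbar v b (z - ζ • v) := by
  have hline : HasFDerivAt (fun ζ : ℂ => z - ζ • v)
      (-(ContinuousLinearMap.toSpanSingleton ℂ v).restrictScalars ℝ) ζ :=
    ((ContinuousLinearMap.toSpanSingleton ℂ v).restrictScalars ℝ).hasFDerivAt.const_sub z
  have hcomp : fderiv ℝ (fun ζ : ℂ => b (z - ζ • v)) ζ = _ :=
    ((hb _).hasFDerivAt.comp ζ hline).fderiv
  simp only [dbar, hcomp, ContinuousLinearMap.comp_apply, neg_apply,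
    ContinuousLinearMap.coe_restrictScalars', ContinuousLinearMap.toSpanSingleton_apply,
    smul_eq_mul, mul_one, one_smul, map_neg]
  ring

variable {L : X →L[ℝ] ℂ} {M : ℝ} {a : X → ℂ}

theorem norm_le_of_sub_smul_mem_strip (hL : ∀ ζ : ℂ, L (ζ • v) = ζ) {ζ : ℂ}
    (h : z - ζ • v ∈ L ⁻¹' closedBall 0 M) : ‖ζ‖ ≤ ‖L z‖ + M := by
  rw [mem_preimage, mem_closedBall_zero_iff, map_sub, hL] at h
  calc ‖ζ‖ = ‖L z - (L z - ζ)‖ := by rw [sub_sub_cancel]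
    _ ≤ ‖L z‖ + ‖L z - ζ‖ := norm_sub_le _ _
    _ ≤ ‖L z‖ + M := by gcongr

theorem isClosed_strip (L : X →L[ℝ] ℂ) (M : ℝ) : IsClosed (L ⁻¹' closedBall 0 M) :=
  isClosed_closedBall.preimage L.continuous

theorem hasCompactSupport_comp_line (hL : ∀ ζ : ℂ, L (ζ • v) = ζ) {F : Type*}
    [NormedAddCommGroup F] {g : X → F} (hg : Function.support g ⊆ L ⁻¹' closedBall 0 M) (z : X) :
    HasCompactSupport fun ζ : ℂ => g (z - ζ • v) := by
  refine .intro (isCompact_closedBall (0 : ℂ) (‖L z‖ + M)) fun ζ hζ => ?_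
  by_contra hne
  exact hζ (mem_closedBall_zero_iff.2 (norm_le_of_sub_smul_mem_strip hL (hg hne)))

theorem integrable_inv_mul_comp_line (hL : ∀ ζ : ℂ, L (ζ • v) = ζ) (ha : Continuous a)
    (hM : Function.support a ⊆ L ⁻¹' closedBall 0 M) (z : X) :
    Integrable fun ζ : ℂ => ζ⁻¹ * a (z - ζ • v) :=
  locallyIntegrable_inv_complex.integrable_smul_right_of_hasCompactSupport (by fun_prop)
    (hasCompactSupport_comp_line hL hM z)

theorem cauchyTransform_dbar (hL : ∀ ζ : ℂ, L (ζ • v) = ζ) {b : X → ℂ} (hb : ContDiff ℝ 1 b)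
    (hM : Function.support b ⊆ L ⁻¹' closedBall 0 M) (z : X) :
    cauchyTransform v (dbar v b) z = b z := by
  have hφ : ContDiff ℝ 1 fun ζ : ℂ => b (z - ζ • v) := by fun_prop
  have hpompeiu := cauchyPompeiu_zero hφ (hasCompactSupport_comp_line hL hM z)
  simp only [dbar_one_comp_line (hb.differentiable one_ne_zero), mul_neg, integral_neg, neg_inj,
    zero_smul, sub_zero] at hpompeiu
  rw [cauchyTransform, hpompeiu,
    inv_mul_cancel_left₀ (Complex.ofReal_ne_zero.2 Real.pi_ne_zero)]

theorem support_fderiv_subset_strip {F : Type*} [NormedAddCommGroup F] [NormedSpace ℝ F] {g : X → F}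
    (hM : Function.support g ⊆ L ⁻¹' closedBall 0 M) :
    Function.support (fderiv ℝ g) ⊆ L ⁻¹' closedBall 0 M :=
  (support_fderiv_subset ℝ).trans (closure_minimal hM (isClosed_strip L M))

theorem hasFDerivAt_cauchyTransform (hL : ∀ ζ : ℂ, L (ζ • v) = ζ) (ha : ContDiff ℝ 1 a)
    (hM : Function.support a ⊆ L ⁻¹' closedBall 0 M) (z : X) :
    ∃ D : X →L[ℝ] ℂ, HasFDerivAt (cauchyTransform v a) D z ∧
      ∀ w, D w = cauchyTransform v (fun y => fderiv ℝ a y w) z := by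
  let Φ : X × ℂ →L[ℝ] X := .fst ℝ X ℂ +
    ((ContinuousLinearMap.toSpanSingleton ℂ v).restrictScalars ℝ).comp (.snd ℝ X ℂ)
  have hΦ (y : X) (ζ : ℂ) : Φ (y, ζ) = y - (-ζ) • v := by simp [Φ]
  let g : X → ℂ → ℂ := fun y ζ => a (Φ (y, ζ))
  have hg : ContDiff ℝ 1 ↿g := ha.comp Φ.contDiff
  have hg' (y : X) (ζ : ℂ) : fderiv ℝ ↿g (y, ζ) = (fderiv ℝ a (Φ (y, ζ))).comp Φ :=
    ((ha.differentiable one_ne_zero _).hasFDerivAt.comp _ Φ.hasFDerivAt).fderiv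
  have hsupp (y : X) (ζ : ℂ) (hy : y ∈ {y | ‖L y‖ < ‖L z‖ + 1})
      (hζ : ζ ∉ closedBall (0 : ℂ) (‖L z‖ + 1 + M)) : g y ζ = 0 := by
    by_contra hne
    have hle := norm_le_of_sub_smul_mem_strip hL (hΦ y ζ ▸ hM hne)
    rw [norm_neg] at hle
    exact hζ (mem_closedBall_zero_iff.2 (by linarith [hy.out]))
  have hconv := hasFDerivAt_convolution_right_with_param (μ := volume)
    (ContinuousLinearMap.mul ℝ ℂ) (isOpen_lt (by fun_prop) continuous_const)
    (isCompact_closedBall _ _) hsupp locallyIntegrable_inv_complex hg.contDiffOn (z, 0)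
    (lt_add_one ‖L z‖)
  have hsupp' : HasCompactSupport fun ζ : ℂ => fderiv ℝ ↿g (z, ζ) := by
    have hline := hasCompactSupport_comp_line hL (support_fderiv_subset_strip hM) z
    have hcomp : (fun ζ : ℂ => fderiv ℝ ↿g (z, ζ)) = (fun A : X →L[ℝ] ℂ => A.comp Φ) ∘
        (fun ζ : ℂ => fderiv ℝ a (z - ζ • v)) ∘ Homeomorph.neg ℂ :=
      funext fun ζ => by simp [hg', hΦ]
    rw [hcomp]
    exact (hline.comp_homeomorph _).comp_left (ContinuousLinearMap.zero_comp Φ)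
  have hT : cauchyTransform v a =
      fun y => (Real.pi : ℂ)⁻¹ * convolution (·⁻¹) (g y) (ContinuousLinearMap.mul ℝ ℂ) volume 0 :=
    funext fun y => by simp [cauchyTransform, convolution_def, g, hΦ, sub_eq_add_neg]
  have hpair := HasFDerivAt.comp (f := fun y => (y, (0 : ℂ))) z hconv (hasFDerivAt_prodMk_left z 0)
  rw [hT]
  refine ⟨_, hpair.const_mul (Real.pi : ℂ)⁻¹, fun w => ?_⟩
  rw [smul_apply, ContinuousLinearMap.comp_apply, convolution_precompR_apply _
    locallyIntegrable_inv_complex hsupp' ((hg.continuous_fderiv one_ne_zero).comp (by fun_prop))]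
  simp [cauchyTransform, convolution_def, hg', hΦ, sub_eq_add_neg]

theorem dbar_cauchyTransform (hL : ∀ ζ : ℂ, L (ζ • v) = ζ) (ha : ContDiff ℝ 1 a)
    (hM : Function.support a ⊆ L ⁻¹' closedBall 0 M) (w z : X) :
    dbar w (cauchyTransform v a) z = cauchyTransform v (dbar w a) z := by
  obtain ⟨D, hD, hDw⟩ := hasFDerivAt_cauchyTransform hL ha hM z
  have hint (w : X) : Integrable fun ζ : ℂ => ζ⁻¹ * fderiv ℝ a (z - ζ • v) w := by
    have := ha.continuous_fderiv one_ne_zero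
    refine integrable_inv_mul_comp_line (M := M) (a := fun y => fderiv ℝ a y w) hL (by fun_prop)
      (fun y hy => support_fderiv_subset_strip hM fun h0 => hy (by simp [h0])) z
  have hsplit : ∫ ζ : ℂ, ζ⁻¹ * dbar w a (z - ζ • v) =
      2⁻¹ * ((∫ ζ : ℂ, ζ⁻¹ * fderiv ℝ a (z - ζ • v) w) +
        Complex.I * ∫ ζ : ℂ, ζ⁻¹ * fderiv ℝ a (z - ζ • v) (Complex.I • w)) := by
    rw [← integral_const_mul, ← integral_add (hint w) ((hint _).const_mul _), ← integral_const_mul]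
    refine integral_congr_ae (.of_forall fun ζ => ?_)
    simp only [dbar]
    ring
  rw [dbar, hD.fderiv, hDw, hDw]
  simp only [cauchyTransform, hsplit]
  ring

theorem cauchyTransform_eq_zero {s : Set X} (hs : ∀ ζ : ℂ, z - ζ • v ∈ s) (ha : EqOn a 0 s) :
    cauchyTransform v a z = 0 := by
  simp [cauchyTransform, fun ζ => ha (hs ζ)]

end CauchyTransform

section Young

variable {X Y Z : Type*} [MeasurableSpace X] [MeasurableSpace Y]

theorem rpow_lintegral_le_mul_lintegral_rpow {p : ℝ} (hp : 1 ≤ p) (ν : Measure Y) {h : Y → ℝ≥0∞}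
    (hh : AEMeasurable h ν) :
    (∫⁻ t, h t ∂ν) ^ p ≤ ν univ ^ (p - 1) * ∫⁻ t, h t ^ p ∂ν := by
  have hp0 : 0 < p := by linarith
  have hjensen := eLpNorm'_le_eLpNorm'_mul_rpow_measure_univ one_pos hp hh.aestronglyMeasurable
  simp only [eLpNorm', ENNReal.rpow_one, one_div, inv_one, enorm_eq_self] at hjensen
  calc (∫⁻ t, h t ∂ν) ^ p
      ≤ ((∫⁻ t, h t ^ p ∂ν) ^ p⁻¹ * ν univ ^ (1 - p⁻¹)) ^ p := by gcongr
    _ = ν univ ^ (p - 1) * ∫⁻ t, h t ^ p ∂ν := by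
      rw [ENNReal.mul_rpow_of_nonneg _ _ hp0.le, ← ENNReal.rpow_mul, ← ENNReal.rpow_mul,
        inv_mul_cancel₀ hp0.ne', ENNReal.rpow_one, mul_comm, sub_mul, inv_mul_cancel₀ hp0.ne',
        one_mul]

theorem lintegral_rpow_lintegral_sub_le [AddCommGroup X] [MeasurableSub₂ X] [MeasurableAdd X]
    {μ : Measure X} [SFinite μ] [μ.IsAddRightInvariant] {ν : Measure Y} [SFinite ν] {p : ℝ}
    (hp : 1 ≤ p) {g : X → ℝ≥0∞} (hg : Measurable g) {τ : Y → X} (hτ : Measurable τ) :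
    ∫⁻ z, (∫⁻ t, g (z - τ t) ∂ν) ^ p ∂μ ≤ ν univ ^ (p - 1) * (ν univ * ∫⁻ z, g z ^ p ∂μ) :=
  calc ∫⁻ z, (∫⁻ t, g (z - τ t) ∂ν) ^ p ∂μ
      ≤ ∫⁻ z, ν univ ^ (p - 1) * ∫⁻ t, g (z - τ t) ^ p ∂ν ∂μ :=
        lintegral_mono fun z => rpow_lintegral_le_mul_lintegral_rpow hp ν (by fun_prop)
    _ = ν univ ^ (p - 1) * ∫⁻ t, ∫⁻ z, g (z - τ t) ^ p ∂μ ∂ν := by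
        rw [lintegral_const_mul _ (by fun_prop), lintegral_lintegral_swap (by fun_prop)]
    _ = ν univ ^ (p - 1) * (ν univ * ∫⁻ z, g z ^ p ∂μ) := by
        simp only [lintegral_sub_right_eq_self fun z => g z ^ p]
        rw [lintegral_const, mul_comm (ν univ) (∫⁻ z, g z ^ p ∂μ)]

variable [NormedAddCommGroup Z] [NormedSpace ℂ Z] {v : Z} {L : Z →L[ℝ] ℂ} {M : ℝ} {a : Z → ℂ}

theorem continuous_cauchyTransform (hL : ∀ ζ : ℂ, L (ζ • v) = ζ) (ha : ContDiff ℝ 1 a)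
    (hM : Function.support a ⊆ L ⁻¹' closedBall 0 M) : Continuous (cauchyTransform v a) :=
  continuous_iff_continuousAt.2 fun z =>
    let ⟨_, hD, _⟩ := hasFDerivAt_cauchyTransform hL ha hM z
    hD.continuousAt

/-- The measure `|ζ|⁻¹ dζ` on the closed disc of radius `ρ`. -/
noncomputable def cauchyKernelMeasure (ρ : ℝ) : Measure ℂ :=
  (volume.restrict (closedBall 0 ρ)).withDensity fun ζ => ‖ζ⁻¹‖ₑ

instance (ρ : ℝ) : IsFiniteMeasure (cauchyKernelMeasure ρ) :=
  isFiniteMeasure_withDensity (locallyIntegrable_inv_complex.integrableOn_isCompact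
    (isCompact_closedBall (0 : ℂ) ρ)).hasFiniteIntegral.ne

theorem enorm_cauchyTransform_le (hL : ∀ ζ : ℂ, L (ζ • v) = ζ) (ha : Continuous a)
    (hM : Function.support a ⊆ L ⁻¹' closedBall 0 M) {z : Z} (hz : z ∈ L ⁻¹' closedBall 0 M) :
    ‖cauchyTransform v a z‖ₑ ≤
      ‖(Real.pi : ℂ)⁻¹‖ₑ * ∫⁻ ζ, ‖a (z - ζ • v)‖ₑ ∂cauchyKernelMeasure (M + M) := by
  have hsub : Function.support (fun ζ : ℂ => ‖ζ⁻¹‖ₑ * ‖a (z - ζ • v)‖ₑ) ⊆ closedBall 0 (M + M) := by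
    intro ζ hζ
    have hne : a (z - ζ • v) ≠ 0 := fun h0 => hζ (by simp [h0])
    have hle := norm_le_of_sub_smul_mem_strip hL (hM hne)
    have hz' : ‖L z‖ ≤ M := mem_closedBall_zero_iff.1 hz
    exact mem_closedBall_zero_iff.2 (by linarith)
  have hmeas : Measurable fun ζ : ℂ => ‖a (z - ζ • v)‖ₑ :=
    (ha.comp (by fun_prop : Continuous fun ζ : ℂ => z - ζ • v)).measurable.enorm
  rw [cauchyTransform, enorm_mul, cauchyKernelMeasure,
    lintegral_withDensity_eq_lintegral_mul _ (by fun_prop) hmeas]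
  simp only [Pi.mul_apply]
  rw [setLIntegral_eq_of_support_subset hsub]
  gcongr
  simpa only [enorm_mul] using
    enorm_integral_le_lintegral_enorm fun ζ : ℂ => ζ⁻¹ * a (z - ζ • v)

theorem memLp_cauchyTransform_strip [FiniteDimensional ℂ Z] [MeasurableSpace Z] [BorelSpace Z]
    {μ : Measure Z} [μ.IsAddHaarMeasure] {p : ℝ≥0∞} (hp : 1 ≤ p) (hp' : p ≠ ∞)
    (hL : ∀ ζ : ℂ, L (ζ • v) = ζ)
    (ha : ContDiff ℝ 1 a) (hM : Function.support a ⊆ L ⁻¹' closedBall 0 M) (hap : MemLp a p μ) :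
    MemLp (cauchyTransform v a) p (μ.restrict (L ⁻¹' closedBall 0 M)) := by
  have hreal : FiniteDimensional ℝ Z := .complexToReal Z
  have hproper : ProperSpace Z := FiniteDimensional.proper ℝ Z
  have hp0 : p ≠ 0 := (one_pos.trans_le hp).ne'
  have hp1 : 1 ≤ p.toReal := by simpa using ENNReal.toReal_mono hp' hp
  refine ⟨(continuous_cauchyTransform hL ha hM).aestronglyMeasurable, ?_⟩
  rw [eLpNorm_lt_top_iff_lintegral_rpow_enorm_lt_top hp0 hp']
  set ν := cauchyKernelMeasure (M + M)
  calc ∫⁻ z in L ⁻¹' closedBall 0 M, ‖cauchyTransform v a z‖ₑ ^ p.toReal ∂μ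
      ≤ ∫⁻ z in L ⁻¹' closedBall 0 M,
          ‖(Real.pi : ℂ)⁻¹‖ₑ ^ p.toReal * (∫⁻ ζ, ‖a (z - ζ • v)‖ₑ ∂ν) ^ p.toReal ∂μ := by
        refine setLIntegral_mono' (isClosed_strip L M).measurableSet fun z hz => ?_
        rw [← ENNReal.mul_rpow_of_nonneg _ _ (by positivity)]
        gcongr
        exact enorm_cauchyTransform_le hL ha.continuous hM hz
    _ ≤ ∫⁻ z, ‖(Real.pi : ℂ)⁻¹‖ₑ ^ p.toReal * (∫⁻ ζ, ‖a (z - ζ • v)‖ₑ ∂ν) ^ p.toReal ∂μ :=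
        setLIntegral_le_lintegral _ _
    _ = ‖(Real.pi : ℂ)⁻¹‖ₑ ^ p.toReal *
          ∫⁻ z, (∫⁻ ζ, ‖a (z - ζ • v)‖ₑ ∂ν) ^ p.toReal ∂μ :=
        lintegral_const_mul' _ _ (by simp)
    _ ≤ ‖(Real.pi : ℂ)⁻¹‖ₑ ^ p.toReal *
          (ν univ ^ (p.toReal - 1) * (ν univ * ∫⁻ z, ‖a z‖ₑ ^ p.toReal ∂μ)) := by
        gcongr
        exact lintegral_rpow_lintegral_sub_le hp1 ha.continuous.measurable.enorm (by fun_prop)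
    _ < ∞ := by
        have := (eLpNorm_lt_top_iff_lintegral_rpow_enorm_lt_top hp0 hp').1 hap.2
        finiteness

end Young

section SeveralVariables

variable {X : Type*} [NormedAddCommGroup X] [NormedSpace ℂ X] {U : Set X} {f g : X → ℂ}

theorem exists_eventually_norm_fderiv_le (hU : IsOpen U) (hf : DifferentiableOn ℂ f U) {z : X}
    (hz : z ∈ U) : ∃ C, ∀ᶠ y in 𝓝 z, ‖fderiv ℂ f y‖ ≤ C := by
  have hc : ContinuousAt f z := (hf.differentiableAt (hU.mem_nhds hz)).continuousAt
  obtain ⟨r, hr, hball⟩ := eventually_nhds_iff_ball.1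
    ((hU.eventually_mem hz).and (hc.eventually (closedBall_mem_nhds _ one_pos)))
  refine ⟨2 / (r / 2), ?_⟩
  filter_upwards [ball_mem_nhds z (half_pos hr)] with y hy
  have hsub : ball y (r / 2) ⊆ ball z r :=
    ball_subset_ball' (by linarith [mem_ball.1 hy])
  have hfy := (hball y (hsub (mem_ball_self (half_pos hr)))).2
  refine Complex.norm_fderiv_le_div_of_mapsTo_ball (hf.mono fun x hx => (hball x (hsub hx)).1)
    (fun x hx => ?_) (half_pos hr)
  have hfx := (hball x (hsub hx)).2
  calc dist (f x) (f y) ≤ dist (f x) (f z) + dist (f y) (f z) := dist_triangle_right _ _ _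
    _ ≤ 1 + 1 := add_le_add hfx hfy
    _ = 2 := one_add_one_eq_two

theorem norm_fderiv_sub_fderiv_le {z y : X} {r C : ℝ} (hr : 0 < r)
    (hf : DifferentiableOn ℂ f (ball z (r + r))) (hC : ∀ x ∈ ball z (r + r), ‖fderiv ℂ f x‖ ≤ C)
    (hy : y ∈ ball z r) : ‖fderiv ℂ f y - fderiv ℂ f z‖ ≤ 2 * (C * ‖y - z‖) / r := by
  have hd : ∀ x ∈ ball z (r + r), DifferentiableAt ℂ f x := fun x hx =>
    hf.differentiableAt (isOpen_ball.mem_nhds hx)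
  have hshift : ∀ x ∈ ball z r, x ∈ ball z (r + r) ∧ x + (y - z) ∈ ball z (r + r) := by
    intro x hx
    rw [mem_ball_iff_norm] at hx hy
    refine ⟨mem_ball_iff_norm.2 (by linarith), mem_ball_iff_norm.2 ?_⟩
    rw [add_sub_right_comm]
    linarith [norm_add_le (x - z) (y - z)]
  have hincr : ∀ x ∈ ball z r, ‖f (x + (y - z)) - f x‖ ≤ C * ‖y - z‖ := fun x hx => by
    simpa only [add_sub_cancel_left] using
      (convex_ball z (r + r)).norm_image_sub_le_of_norm_fderiv_le
        hd hC (hshift x hx).1 (hshift x hx).2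
  have hderiv : ∀ x ∈ ball z r, HasFDerivAt (fun x => f (x + (y - z)) - f x)
      (fderiv ℂ f (x + (y - z)) - fderiv ℂ f x) x := fun x hx =>
    ((hasFDerivAt_comp_add_right _).2 (hd _ (hshift x hx).2).hasFDerivAt).sub
      (hd x (hshift x hx).1).hasFDerivAt
  -- the Schwarz lemma for the increment of `f`
  have hschwarz := Complex.norm_fderiv_le_div_of_mapsTo_ball (R₂ := 2 * (C * ‖y - z‖))
    (fun x hx => (hderiv x hx).differentiableAt.differentiableWithinAt) (fun x hx => ?_) hr
  · rwa [(hderiv z (mem_ball_self hr)).fderiv, add_sub_cancel] at hschwarz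
  · rw [mem_closedBall_iff_norm, two_mul]
    exact (norm_sub_le _ _).trans (add_le_add (hincr x hx) (hincr z (mem_ball_self hr)))

theorem continuousOn_fderiv_of_differentiableOn (hU : IsOpen U) (hf : DifferentiableOn ℂ f U) :
    ContinuousOn (fderiv ℂ f) U := by
  intro z hz
  obtain ⟨C, hC⟩ := exists_eventually_norm_fderiv_le hU hf hz
  obtain ⟨r, hr, hball⟩ := eventually_nhds_iff_ball.1 ((hU.eventually_mem hz).and hC)
  rw [← add_halves r] at hball
  have hbound : ∀ᶠ y in 𝓝 z, ‖fderiv ℂ f y - fderiv ℂ f z‖ ≤ 2 * (C * ‖y - z‖) / (r / 2) := by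
    filter_upwards [ball_mem_nhds z (half_pos hr)] with y hy
    exact norm_fderiv_sub_fderiv_le (half_pos hr) (hf.mono fun x hx => (hball x hx).1)
      (fun x hx => (hball x hx).2) hy
  have hlim : Tendsto (fun y => 2 * (C * ‖y - z‖) / (r / 2)) (𝓝 z) (𝓝 0) := by
    have : Continuous fun y => 2 * (C * ‖y - z‖) / (r / 2) := by fun_prop
    simpa using this.tendsto z
  exact ContinuousAt.continuousWithinAt (tendsto_iff_norm_sub_tendsto_zero.2
    (squeeze_zero' (Eventually.of_forall fun _ => norm_nonneg _) hbound hlim))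

theorem contDiffOn_one_of_differentiableOn (hU : IsOpen U) (hf : DifferentiableOn ℂ f U) :
    ContDiffOn ℝ 1 f U :=
  ContDiffOn.restrict_scalars ℝ ((contDiffOn_succ_iff_fderiv_of_isOpen (n := 0) hU).2
    ⟨hf, by simp, contDiffOn_zero.2 (continuousOn_fderiv_of_differentiableOn hU hf)⟩)

theorem eqOn_of_convex_of_eventuallyEq (hU : IsOpen U) (hc : Convex ℝ U)
    (hf : DifferentiableOn ℂ f U) (hg : DifferentiableOn ℂ g U) {z₀ : X} (hz₀ : z₀ ∈ U)
    (h : f =ᶠ[𝓝 z₀] g) : EqOn f g U := by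
  intro z hz
  let line : ℂ → X := fun t => z₀ + t • (z - z₀)
  have hline : Differentiable ℂ line := by fun_prop
  have hT : IsOpen (line ⁻¹' U) := hU.preimage hline.continuous
  have hTc : Convex ℝ (line ⁻¹' U) := (hc.translate_preimage_right z₀).linear_preimage
    ((LinearMap.toSpanSingleton ℂ X (z - z₀)).restrictScalars ℝ)
  have hanalytic : ∀ {k : X → ℂ}, DifferentiableOn ℂ k U →
      AnalyticOnNhd ℂ (k ∘ line) (line ⁻¹' U) := fun hk =>
    (hk.comp hline.differentiableOn fun _ ht => ht).analyticOnNhd hT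
  have hzero : f ∘ line =ᶠ[𝓝 0] g ∘ line :=
    (by simpa [line] using hline.continuous.tendsto 0 : Tendsto line (𝓝 0) (𝓝 z₀)).eventually h
  have := (hanalytic hf).eqOn_of_preconnected_of_eventuallyEq (hanalytic hg) hTc.isPreconnected
    (by simpa [line] using hz₀) hzero (by simpa [line] using hz : (1 : ℂ) ∈ line ⁻¹' U)
  simpa [line] using this

theorem eqOn_of_isPreconnected_of_eventuallyEq (hU : IsOpen U) (hc : IsPreconnected U)
    (hf : DifferentiableOn ℂ f U) (hg : DifferentiableOn ℂ g U) {z₀ : X} (hz₀ : z₀ ∈ U)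
    (h : f =ᶠ[𝓝 z₀] g) : EqOn f g U := by
  suffices U ⊆ {z | f =ᶠ[𝓝 z] g} from fun z hz => (this hz).eq_of_nhds
  refine hc.subset_of_closure_inter_subset isOpen_setOfPred_eventually_nhds ⟨z₀, hz₀, h⟩ ?_
  rintro q ⟨hq, hqU⟩
  obtain ⟨ε, hε, hball⟩ := isOpen_iff.1 hU q hqU
  obtain ⟨p, hp, hpq⟩ := mem_closure_iff_nhds.1 hq _ (ball_mem_nhds q hε)
  exact mem_of_superset (ball_mem_nhds q hε) (eqOn_of_convex_of_eventuallyEq isOpen_ball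
    (convex_ball q ε) (hf.mono hball) (hg.mono hball) hp hpq)

end SeveralVariables

section Complement

variable {X : Type*} [TopologicalSpace X] [PreconnectedSpace X] [LocallyConnectedSpace X]

theorem nonempty_connectedComponentIn_compl_inter {K Ω : Set X} (hK : IsClosed K)
    (hKne : K.Nonempty) (hΩ : IsOpen Ω) (hKΩ : K ⊆ Ω) {p : X} (hp : p ∈ Kᶜ) :
    (connectedComponentIn Kᶜ p ∩ Ω).Nonempty := by
  set W := connectedComponentIn Kᶜ p
  have hW : IsOpen W := hK.isOpen_compl.connectedComponentIn
  by_contra hdisj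
  rw [not_nonempty_iff_eq_empty, ← Set.disjoint_iff_inter_eq_empty] at hdisj
  have hclosure : closure W ⊆ Kᶜ := fun q hq hqK =>
    Set.disjoint_left.1 (hdisj.closure_left hΩ) hq (hKΩ hqK)
  have hclopen : IsClopen W := ⟨closure_subset_iff_isClosed.1
    (isPreconnected_connectedComponentIn.closure.subset_connectedComponentIn
      (subset_closure (mem_connectedComponentIn hp)) hclosure), hW⟩
  have huniv := hclopen.eq_univ ⟨p, mem_connectedComponentIn hp⟩
  obtain ⟨q, hq⟩ := hKne
  exact connectedComponentIn_subset Kᶜ p (huniv ▸ mem_univ q : q ∈ W) hq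

end Complement

section Cutoff

variable {X : Type*} [NormedAddCommGroup X] [NormedSpace ℝ X] [FiniteDimensional ℝ X]

theorem norm_fderiv_convolution_le [MeasurableSpace X] [BorelSpace X] {μ : Measure X}
    [μ.IsAddHaarMeasure] {F : Type*} [NormedAddCommGroup F] [NormedSpace ℝ F]
    {φ : X → ℝ} (hφ : ContDiff ℝ 1 φ) (hc : HasCompactSupport φ) {g : X → F}
    (hg : LocallyIntegrable g μ) {B : ℝ} (hB : ∀ z, ‖g z‖ ≤ B) (z : X) :
    ‖fderiv ℝ (φ ⋆[ContinuousLinearMap.lsmul ℝ ℝ, μ] g) z‖ ≤ (∫ t, ‖fderiv ℝ φ t‖ ∂μ) * B := by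
  have hint : Integrable (fun t => ‖fderiv ℝ φ t‖) μ :=
    ((hφ.continuous_fderiv one_ne_zero).integrable_of_hasCompactSupport (hc.fderiv ℝ)).norm
  rw [(hc.hasFDerivAt_convolution_left _ hφ hg z).fderiv, ← integral_mul_const]
  refine norm_integral_le_of_norm_le (hint.mul_const B) (Eventually.of_forall fun t => ?_)
  refine ContinuousLinearMap.opNorm_le_bound _
    (mul_nonneg (norm_nonneg _) ((norm_nonneg _).trans (hB z))) fun x => ?_
  rw [ContinuousLinearMap.precompL_apply, ContinuousLinearMap.lsmul_apply, norm_smul,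
    mul_right_comm]
  exact mul_le_mul (ContinuousLinearMap.le_opNorm _ _) (hB _) (norm_nonneg _) (by positivity)

theorem exists_contDiff_cutoff (E : Set X) {r : ℝ} (hr : 0 < r) (n : ℕ∞) :
    ∃ χ : X → ℂ, ContDiff ℝ n χ ∧ (∀ z ∈ E, χ =ᶠ[𝓝 z] 1) ∧ tsupport χ ⊆ cthickening r E ∧
      ∃ C, ∀ z, ‖fderiv ℝ χ z‖ ≤ C := by
  borelize X
  let μ : Measure X := Measure.addHaar
  obtain ⟨δ, hδ, rfl⟩ : ∃ δ, 0 < δ ∧ δ + (δ + δ) = r := ⟨r / 3, by positivity, by ring⟩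
  let φ : ContDiffBump (0 : X) := ⟨δ / 2, δ, half_pos hδ, half_lt_self hδ⟩
  let g : X → ℂ := (thickening (δ + δ) E).indicator 1
  have hg_le : ∀ z, ‖g z‖ ≤ 1 := fun z => (norm_indicator_le_norm_self _ _).trans (by simp)
  have hg : LocallyIntegrable g μ := (locallyIntegrable_const (1 : ℂ)).mono
    (measurable_one.indicator isOpen_thickening.measurableSet).aestronglyMeasurable
    (Eventually.of_forall fun z => by simpa using hg_le z)
  let χ : X → ℂ := φ.normed μ ⋆[ContinuousLinearMap.lsmul ℝ ℝ, μ] g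
  have hχ : ∀ {z c}, (∀ x ∈ ball z δ, g x = c) → χ z = c := fun {z c} h => by
    have hz := h z (mem_ball_self hδ)
    exact (φ.normed_convolution_eq_right fun x hx => (h x hx).trans hz.symm).trans hz
  have hone : ∀ z ∈ thickening δ E, χ z = 1 := fun z hz => hχ fun x hx =>
    indicator_of_mem (thickening_thickening_subset δ δ E (ball_subset_thickening hz δ hx)) _
  have hzero : ∀ z ∉ thickening (δ + (δ + δ)) E, χ z = 0 := fun z hz => hχ fun x hx =>
    indicator_of_notMem (fun hx' => hz (thickening_thickening_subset δ (δ + δ) E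
      (ball_subset_thickening hx' δ (mem_ball_comm.1 hx)))) _
  refine ⟨χ, φ.hasCompactSupport_normed.contDiff_convolution_left _ φ.contDiff_normed hg,
    fun z hz => ?_, ?_, _, norm_fderiv_convolution_le φ.contDiff_normed
      φ.hasCompactSupport_normed hg hg_le⟩
  · exact mem_of_superset (isOpen_thickening.mem_nhds (self_subset_thickening hδ E hz)) hone
  · have hsupp : Function.support χ ⊆ thickening (δ + (δ + δ)) E := fun z hz =>
      by_contra fun h => hz (hzero z h)
    exact (closure_mono hsupp).trans (closure_thickening_subset_cthickening _ _)

end Cutoff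

section TransverseDirection

theorem isBounded_image_thickening {X Y : Type*} [NormedAddCommGroup X] [NormedSpace ℝ X]
    [NormedAddCommGroup Y] [NormedSpace ℝ Y] {L : X →L[ℝ] Y} {H : AffineSubspace ℝ X}
    (hL : H.direction ≤ L.ker) (R : ℝ) : Bornology.IsBounded (L '' thickening R (H : Set X)) := by
  rcases (H : Set X).eq_empty_or_nonempty with hH | ⟨p, hp⟩
  · simp [hH]
  refine isBounded_iff_subset_closedBall (L p) |>.2 ⟨‖L‖ * R, ?_⟩
  rintro _ ⟨z, hz, rfl⟩
  obtain ⟨q, hq, hzq⟩ := mem_thickening_iff.1 hz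
  have hqp : L q = L p := sub_eq_zero.1 <| by
    rw [← map_sub]
    exact hL (AffineSubspace.vsub_mem_direction hq hp)
  rw [mem_closedBall, ← hqp]
  exact (L.dist_le_opNorm z q).trans (by gcongr)

variable {X : Type*} [NormedAddCommGroup X] [NormedSpace ℂ X] [FiniteDimensional ℂ X]
  {V : Submodule ℝ X} {v : X}

-- The vectors `v` that fail form the image of the smooth map `(t, x) ↦ exp (it) • x` on `ℝ × V`,
-- which has dense complement because `dim (ℝ × V) < dim X`.
theorem exists_forall_smul_mem_imp_eq_zero (hV : 2 ≤ finrank ℝ (X ⧸ V)) :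
    ∃ v : X, ∀ ζ : ℂ, ζ • v ∈ V → ζ = 0 := by
  have : FiniteDimensional ℝ X := FiniteDimensional.complexToReal X
  let Φ : ℝ × V → X := fun p => Complex.exp (p.1 * Complex.I) • (p.2 : X)
  have hΦ : ContDiff ℝ 1 Φ :=
    ((Complex.ofRealCLM.contDiff.comp contDiff_fst).mul contDiff_const).cexp.smul
      (V.subtypeL.contDiff.comp contDiff_snd)
  have hdim : finrank ℝ (ℝ × V) < finrank ℝ X := by
    rw [finrank_prod, finrank_self, ← V.finrank_quotient_add_finrank]
    lia
  obtain ⟨v, hv⟩ := (hΦ.dense_compl_range_of_finrank_lt_finrank hdim).nonempty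
  refine ⟨v, fun ζ hζ => by_contra fun h0 => hv ?_⟩
  refine ⟨(-ζ.arg, ⟨(‖ζ‖⁻¹ : ℝ) • ζ • v, V.smul_mem _ hζ⟩), ?_⟩
  have hn : (‖ζ‖ : ℂ) ≠ 0 := by simpa using h0
  have hpolar : Complex.exp ((-ζ.arg : ℝ) * Complex.I) * ((‖ζ‖⁻¹ : ℝ) : ℂ) * ζ = 1 := by
    nth_rw 3 [← Complex.norm_mul_exp_arg_mul_I ζ]
    rw [mul_assoc, Complex.ofReal_inv, inv_mul_cancel_left₀ hn, ← Complex.exp_add]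
    simp
  simp only [Φ]
  rw [← Complex.coe_smul, smul_smul, smul_smul, hpolar, one_smul]

theorem exists_continuousLinearMap_smul_eq (hv : ∀ ζ : ℂ, ζ • v ∈ V → ζ = 0) :
    ∃ L : X →L[ℝ] ℂ, (∀ ζ : ℂ, L (ζ • v) = ζ) ∧ V ≤ L.ker := by
  have : FiniteDimensional ℝ X := FiniteDimensional.complexToReal X
  let ι : ℂ →ₗ[ℝ] X ⧸ V := V.mkQ ∘ₗ (LinearMap.toSpanSingleton ℂ X v).restrictScalars ℝ
  have hι : LinearMap.ker ι = ⊥ := LinearMap.ker_eq_bot'.2 fun ζ hζ =>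
    hv ζ ((Submodule.Quotient.mk_eq_zero V).1 hζ)
  obtain ⟨g, hg⟩ := ι.exists_leftInverse_of_injective hι
  refine ⟨LinearMap.toContinuousLinearMap (g ∘ₗ V.mkQ), LinearMap.congr_fun hg, fun x hx => ?_⟩
  have : V.mkQ x = 0 := (Submodule.Quotient.mk_eq_zero V).2 hx
  simp [this]

theorem exists_functional_vanishing (hV : 3 ≤ finrank ℝ (X ⧸ V)) (v : X) :
    ∃ ℓ : X →L[ℝ] ℝ, ℓ ≠ 0 ∧ V ≤ ℓ.ker ∧ ∀ ζ : ℂ, ℓ (ζ • v) = 0 := by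
  have : FiniteDimensional ℝ X := FiniteDimensional.complexToReal X
  let ι : ℂ →ₗ[ℝ] X := (LinearMap.toSpanSingleton ℂ X v).restrictScalars ℝ
  have hlt : V ⊔ LinearMap.range ι < ⊤ := by
    refine Submodule.lt_top_of_finrank_lt_finrank ?_
    have hsup := Submodule.finrank_add_le_finrank_add_finrank V (LinearMap.range ι)
    have hrange := LinearMap.finrank_range_le ι
    rw [Complex.finrank_real_complex] at hrange
    have hquot := V.finrank_quotient_add_finrank
    lia
  obtain ⟨ℓ, hℓ, hker⟩ := Submodule.exists_le_ker_of_lt_top _ hlt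
  exact ⟨LinearMap.toContinuousLinearMap ℓ, by simpa using hℓ,
    fun x hx => hker (Submodule.mem_sup_left hx), fun ζ => hker (Submodule.mem_sup_right ⟨ζ, rfl⟩)⟩

end TransverseDirection

section HartogsExtension

variable {X : Type*} [NormedAddCommGroup X] [NormedSpace ℂ X] {f χ : X → ℂ} {U : Set X}
  {v w z : X} {L : X →L[ℝ] ℂ} {M : ℝ}

theorem support_mul_dbar_subset (f χ : X → ℂ) (w : X) :
    Function.support (f * dbar w χ) ⊆ tsupport (fderiv ℝ χ) :=
  (Function.support_mul_subset_right _ _).trans (support_dbar_subset w χ)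

theorem mul_dbar_eventuallyEq_zero (hz : z ∉ tsupport (fderiv ℝ χ)) (w : X) :
    f * dbar w χ =ᶠ[𝓝 z] 0 :=
  mem_of_superset ((isClosed_tsupport _).isOpen_compl.mem_nhds hz) fun _ hy =>
    Function.notMem_support.1 fun h => hy (support_mul_dbar_subset f χ w h)

theorem contDiff_mul_dbar (hU : IsOpen U) (hf : DifferentiableOn ℂ f U) (hχ : ContDiff ℝ 2 χ)
    (hχU : tsupport (fderiv ℝ χ) ⊆ U) (w : X) : ContDiff ℝ 1 (f * dbar w χ) := by
  refine contDiff_iff_contDiffAt.2 fun z => ?_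
  by_cases hz : z ∈ tsupport (fderiv ℝ χ)
  · exact ((contDiffOn_one_of_differentiableOn hU hf).contDiffAt (hU.mem_nhds (hχU hz))).mul
      (contDiff_dbar hχ (by norm_num) w).contDiffAt
  · exact contDiffAt_const.congr_of_eventuallyEq (mul_dbar_eventuallyEq_zero hz w)

theorem dbar_mul_dbar_comm (hU : IsOpen U) (hf : DifferentiableOn ℂ f U) (hχ : ContDiff ℝ 2 χ)
    (hχU : tsupport (fderiv ℝ χ) ⊆ U) (v w : X) :
    dbar w (f * dbar v χ) = dbar v (f * dbar w χ) := by
  ext z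
  by_cases hz : z ∈ tsupport (fderiv ℝ χ)
  · have hfz : DifferentiableAt ℂ f z := hf.differentiableAt (hU.mem_nhds (hχU hz))
    have hd (w : X) : DifferentiableAt ℝ (dbar w χ) z :=
      (contDiff_dbar (m := 1) hχ (by norm_num) w).differentiable one_ne_zero z
    rw [dbar_mul (hfz.restrictScalars ℝ) (hd v), dbar_mul (hfz.restrictScalars ℝ) (hd w),
      dbar_eq_zero hfz, dbar_eq_zero hfz, dbar_comm hχ]
    ring
  · rw [dbar_congr (mul_dbar_eventuallyEq_zero hz v), dbar_congr (mul_dbar_eventuallyEq_zero hz w)]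
    simp [dbar]

variable (hL : ∀ ζ : ℂ, L (ζ • v) = ζ) (hM : tsupport (fderiv ℝ χ) ⊆ L ⁻¹' closedBall 0 M)
  (hU : IsOpen U) (hf : DifferentiableOn ℂ f U) (hχ : ContDiff ℝ 2 χ)
  (hχU : tsupport (fderiv ℝ χ) ⊆ U)
include hL hM hU hf hχ hχU

theorem differentiable_cauchyTransform_mul_dbar :
    Differentiable ℝ (cauchyTransform v (f * dbar v χ)) := fun z => by
  obtain ⟨D, hD, -⟩ := hasFDerivAt_cauchyTransform hL (contDiff_mul_dbar hU hf hχ hχU v)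
    ((support_mul_dbar_subset f χ v).trans hM) z
  exact hD.differentiableAt

theorem dbar_cauchyTransform_mul_dbar (w z : X) :
    dbar w (cauchyTransform v (f * dbar v χ)) z = f z * dbar w χ z := by
  have hsmooth := contDiff_mul_dbar hU hf hχ hχU
  have hsupp (w : X) := (support_mul_dbar_subset f χ w).trans hM
  rw [dbar_cauchyTransform hL (hsmooth v) (hsupp v), dbar_mul_dbar_comm hU hf hχ hχU v w,
    cauchyTransform_dbar hL (hsmooth w) (hsupp w), Pi.mul_apply]

theorem eqOn_zero_cauchyTransform_mul_dbar {W : Set X} (hW : IsOpen W) (hWc : IsPreconnected W)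
    (hχW : Disjoint W (tsupport χ)) {p : X} (hp : p ∈ W)
    (hp0 : cauchyTransform v (f * dbar v χ) =ᶠ[𝓝 p] 0) :
    EqOn (cauchyTransform v (f * dbar v χ)) 0 W := by
  refine eqOn_of_isPreconnected_of_eventuallyEq hW hWc (fun z hz => ?_)
    (differentiableOn_const 0) hp hp0
  refine (differentiableAt_complex_of_dbar_eq_zero
    (differentiable_cauchyTransform_mul_dbar hL hM hU hf hχ hχU z)
    fun w => ?_).differentiableWithinAt
  rw [dbar_cauchyTransform_mul_dbar hL hM hU hf hχ hχU]
  exact Function.notMem_support.1 fun h => Set.disjoint_left.1 hχW hz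
    (tsupport_fderiv_subset ℝ (support_mul_dbar_subset f χ w h))

omit hL hM hU hf hχ hχU

/-- The candidate extension of `f` across the region where the cutoff function `χ` equals `1`: the
function `(1 - χ) * f`, corrected by a solution `u` of `∂̄u = f ∂̄χ` obtained from the Cauchy
transform along the complex lines parallel to `v`. -/
noncomputable def hartogsExtension (v : X) (χ f : X → ℂ) : X → ℂ :=
  (1 - χ) * f + cauchyTransform v (f * dbar v χ)

theorem hartogsExtension_apply_of_eq_one (hz : χ z = 1) :
    hartogsExtension v χ f z = cauchyTransform v (f * dbar v χ) z := by
  simp [hartogsExtension, hz]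

include hU hf hχ in
theorem differentiableAt_and_dbar_one_sub_mul (hz : z ∈ U ∨ χ =ᶠ[𝓝 z] 1) :
    DifferentiableAt ℝ ((1 - χ) * f) z ∧ ∀ w, dbar w ((1 - χ) * f) z = -(f z * dbar w χ z) := by
  rcases hz with hz | hz
  · have hfz : DifferentiableAt ℂ f z := hf.differentiableAt (hU.mem_nhds hz)
    have hχz : DifferentiableAt ℝ (1 - χ) z :=
      (differentiableAt_const 1).sub (hχ.differentiable two_ne_zero z)
    refine ⟨hχz.mul (hfz.restrictScalars ℝ), fun w => ?_⟩
    have hneg : dbar w (1 - χ) z = -dbar w χ z := by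
      have hfd : fderiv ℝ (1 - χ) z = -fderiv ℝ χ z := fderiv_const_sub 1
      rw [dbar, dbar, hfd, neg_apply, neg_apply]
      ring
    rw [dbar_mul hχz (hfz.restrictScalars ℝ), dbar_eq_zero hfz, hneg]
    ring
  · have hzero : (1 - χ) * f =ᶠ[𝓝 z] 0 := by
      filter_upwards [hz] with y hy
      simp [hy]
    refine ⟨hzero.differentiableAt_iff.2 (differentiableAt_const 0), fun w => ?_⟩
    rw [dbar_congr hzero, dbar_congr hz]
    simp [dbar]

include hL hM hU hf hχ hχU in
theorem differentiableAt_hartogsExtension (hz : z ∈ U ∨ χ =ᶠ[𝓝 z] 1) :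
    DifferentiableAt ℂ (hartogsExtension v χ f) z := by
  obtain ⟨hd, hdbar⟩ := differentiableAt_and_dbar_one_sub_mul hU hf hχ hz
  have hu := differentiable_cauchyTransform_mul_dbar hL hM hU hf hχ hχU z
  refine differentiableAt_complex_of_dbar_eq_zero (hd.add hu) fun w => ?_
  rw [hartogsExtension, dbar_add hd hu, hdbar,
    dbar_cauchyTransform_mul_dbar hL hM hU hf hχ hχU, neg_add_cancel]

include hL hM hU hf hχ hχU in
theorem eqOn_hartogsExtension (hUc : IsPreconnected U) {W : Set X} (hW : IsOpen W)
    (hWc : IsPreconnected W) (hχW : Disjoint W (tsupport χ)) (hWU : (W ∩ U).Nonempty) {p : X}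
    (hp : p ∈ W) (hp0 : cauchyTransform v (f * dbar v χ) =ᶠ[𝓝 p] 0) :
    EqOn (hartogsExtension v χ f) f U := by
  have hu := eqOn_zero_cauchyTransform_mul_dbar hL hM hU hf hχ hχU hW hWc hχW hp hp0
  obtain ⟨q, hqW, hqU⟩ := hWU
  refine eqOn_of_isPreconnected_of_eventuallyEq hU hUc (fun z hz =>
    (differentiableAt_hartogsExtension hL hM hU hf hχ hχU (.inl hz)).differentiableWithinAt)
    hf hqU (mem_of_superset (hW.mem_nhds hqW) fun z hz => ?_)
  have hχz : χ z = 0 := image_eq_zero_of_notMem_tsupport (Set.disjoint_left.1 hχW hz)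
  simp [hartogsExtension, hu hz, hχz]

end HartogsExtension

section Integrability

theorem memLp_restrict_union {Y : Type*} [MeasurableSpace Y] {μ : Measure Y} {p : ℝ≥0∞}
    {f : Y → ℂ} {s t : Set Y} (hs : MeasurableSet s) (ht : MeasurableSet t)
    (hfs : MemLp f p (μ.restrict s)) (hft : MemLp f p (μ.restrict t)) :
    MemLp f p (μ.restrict (s ∪ t)) := by
  rw [← memLp_indicator_iff_restrict (hs.union ht), ← union_sdiff_self,
    indicator_union_of_disjoint disjoint_sdiff_self_right]
  exact ((memLp_indicator_iff_restrict hs).2 hfs).add ((memLp_indicator_iff_restrict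
    (ht.diff hs)).2 (hft.mono_measure (Measure.restrict_mono sdiff_subset le_rfl)))

variable {X : Type*} [NormedAddCommGroup X] [NormedSpace ℂ X] [FiniteDimensional ℂ X]
  [MeasurableSpace X] [BorelSpace X] {μ : Measure X} {p : ℝ≥0∞} {f χ : X → ℂ} {U E : Set X}
  {v : X} {L : X →L[ℝ] ℂ} {M C : ℝ}

theorem memLp_mul_dbar (hU : IsOpen U) (hf : DifferentiableOn ℂ f U) (hχ : ContDiff ℝ 2 χ)
    (hχU : tsupport (fderiv ℝ χ) ⊆ U) (hC : ∀ z, ‖fderiv ℝ χ z‖ ≤ C) (v : X)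
    (hfp : MemLp f p (μ.restrict U)) : MemLp (f * dbar v χ) p μ := by
  have : FiniteDimensional ℝ X := FiniteDimensional.complexToReal X
  have : ProperSpace X := FiniteDimensional.proper ℝ X
  refine ((memLp_indicator_iff_restrict hU.measurableSet).2 hfp).of_le_mul (c := ‖v‖ * C)
    (contDiff_mul_dbar hU hf hχ hχU v).continuous.aestronglyMeasurable (.of_forall fun z => ?_)
  by_cases hz : z ∈ U
  · rw [indicator_of_mem hz, Pi.mul_apply, norm_mul, mul_comm]
    gcongr
    exact (norm_dbar_le v χ z).trans (by gcongr; exact hC z)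
  · have hzero := (mul_dbar_eventuallyEq_zero (f := f) (fun h => hz (hχU h)) v).eq_of_nhds
    rw [hzero, indicator_of_notMem hz]
    simp

theorem memLp_hartogsExtension [μ.IsAddHaarMeasure] (hp : 1 ≤ p) (hp' : p ≠ ∞)
    (hL : ∀ ζ : ℂ, L (ζ • v) = ζ) (hM : tsupport (fderiv ℝ χ) ⊆ L ⁻¹' closedBall 0 M)
    (hU : IsOpen U) (hf : DifferentiableOn ℂ f U) (hχ : ContDiff ℝ 2 χ)
    (hχU : tsupport (fderiv ℝ χ) ⊆ U) (hC : ∀ z, ‖fderiv ℝ χ z‖ ≤ C)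
    (hE : MeasurableSet E) (hEM : E ⊆ L ⁻¹' closedBall 0 M) (hχE : EqOn χ 1 E)
    (hext : EqOn (hartogsExtension v χ f) f U) (hfp : MemLp f p (μ.restrict U)) :
    MemLp (hartogsExtension v χ f) p (μ.restrict (U ∪ E)) := by
  refine memLp_restrict_union hU.measurableSet hE (hfp.ae_eq ?_) (MemLp.ae_eq ?_
    ((memLp_cauchyTransform_strip hp hp' hL (contDiff_mul_dbar hU hf hχ hχU v)
      ((support_mul_dbar_subset f χ v).trans hM)
      (memLp_mul_dbar hU hf hχ hχU hC v hfp)).mono_measure (Measure.restrict_mono hEM le_rfl)))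
  · exact ae_restrict_of_forall_mem hU.measurableSet fun z hz => (hext hz).symm
  · exact ae_restrict_of_forall_mem hE fun z hz =>
      (hartogsExtension_apply_of_eq_one (hχE hz)).symm

end Integrability

section Extension

variable {X : Type*} [NormedAddCommGroup X] [NormedSpace ℂ X] {Ω E : Set X} {v : X}

theorem tsupport_fderiv_subset_sdiff {χ : X → ℂ} (hχE : ∀ z ∈ E, χ =ᶠ[𝓝 z] 1) :
    tsupport (fderiv ℝ χ) ⊆ tsupport χ \ E := fun z hz =>
  ⟨tsupport_fderiv_subset ℝ hz, fun hzE => notMem_tsupport_iff_eventuallyEq.2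
    (by simpa using (hχE z hzE).fderiv (𝕜 := ℝ)) hz⟩

theorem exists_cauchyTransform_eventuallyEq_zero {ℓ : X →L[ℝ] ℝ} (hℓ : ℓ ≠ 0)
    (hℓv : ∀ ζ : ℂ, ℓ (ζ • v) = 0) {S : Set X} (hS : Bornology.IsBounded (ℓ '' S)) {a : X → ℂ}
    (ha : Function.support a ⊆ S) : ∃ p ∉ S, cauchyTransform v a =ᶠ[𝓝 p] 0 := by
  obtain ⟨M, hM⟩ := hS.bddAbove
  have hle : ∀ z ∈ S, ℓ z ≤ M := fun z hz => hM (mem_image_of_mem ℓ hz)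
  obtain ⟨p, hp⟩ := (LinearMap.surjective (f := (ℓ : X →ₗ[ℝ] ℝ)) fun h =>
    hℓ (ContinuousLinearMap.coe_injective h)) (M + 1)
  have hMp : M < ℓ p := (lt_add_one M).trans_eq hp.symm
  refine ⟨p, fun hpS => (hle p hpS).not_gt hMp, ?_⟩
  -- the lines parallel to `v` stay in the half-space `M < ℓ`, where `a` vanishes
  filter_upwards [(isOpen_lt continuous_const ℓ.continuous).mem_nhds hMp] with z hz
  refine cauchyTransform_eq_zero (s := {z | M < ℓ z}) (fun ζ => ?_) fun y hy =>
    Function.notMem_support.1 fun h => (hle y (ha h)).not_gt hy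
  simpa [hℓv] using hz

theorem eqOn_hartogsExtension_sdiff {L : X →L[ℝ] ℂ} (hL : ∀ ζ : ℂ, L (ζ • v) = ζ)
    {χ f : X → ℂ} {M : ℝ} (hM : tsupport χ ⊆ L ⁻¹' closedBall 0 M) {ℓ : X →L[ℝ] ℝ} (hℓ : ℓ ≠ 0)
    (hℓv : ∀ ζ : ℂ, ℓ (ζ • v) = 0) (hℓχ : Bornology.IsBounded (ℓ '' tsupport χ)) (hΩ : IsOpen Ω)
    (hU : IsOpen (Ω \ E)) (hc : IsPreconnected (Ω \ E)) (hf : DifferentiableOn ℂ f (Ω \ E))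
    (hχ : ContDiff ℝ 2 χ) (hχU : tsupport (fderiv ℝ χ) ⊆ Ω \ E) (hE : E.Nonempty)
    (hEχ : E ⊆ tsupport χ) (hχΩ : tsupport χ ⊆ Ω) :
    EqOn (hartogsExtension v χ f) f (Ω \ E) := by
  obtain ⟨p, hp, hp0⟩ := exists_cauchyTransform_eventuallyEq_zero hℓ hℓv hℓχ
    ((support_mul_dbar_subset f χ v).trans (tsupport_fderiv_subset ℝ))
  obtain ⟨q, hqW, hqΩ⟩ := nonempty_connectedComponentIn_compl_inter (isClosed_tsupport χ)
    (hE.mono hEχ) hΩ hχΩ hp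
  have hW := connectedComponentIn_subset (tsupport χ)ᶜ p
  exact eqOn_hartogsExtension hL ((tsupport_fderiv_subset ℝ).trans hM) hU hf hχ hχU hc
    (isClosed_tsupport χ).isOpen_compl.connectedComponentIn isPreconnected_connectedComponentIn
    (subset_compl_iff_disjoint_right.1 hW) ⟨q, hqW, hqΩ, fun hqE => hW hqW (hEχ hqE)⟩
    (mem_connectedComponentIn hp) hp0

/-- The function `F` is holomorphic on the open set `U` and lies in `L^p(U, μ)`; its values outside
`U` play no role. For `p = 2` and Lebesgue measure on `ℂⁿ` this is `IsL2Holomorphic`. -/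
def IsLpHolomorphic [MeasurableSpace X] (p : ℝ≥0∞) (μ : Measure X) (U : Set X) (F : X → ℂ) :
    Prop :=
  DifferentiableOn ℂ F U ∧ MemLp F p (μ.restrict U)

theorem bijOn_domRestrict_isLpHolomorphic [MeasurableSpace X] {p : ℝ≥0∞} {μ : Measure X}
    (hΩ : IsOpen Ω) (hΩc : IsPreconnected Ω) {U : Set X} (hU : IsOpen U) (hUne : U.Nonempty)
    (hUΩ : U ⊆ Ω) (hext : ∀ f, IsLpHolomorphic p μ U f →
      ∃ F, IsLpHolomorphic p μ Ω F ∧ EqOn F f U) :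
    BijOn (domRestrict₂ hUΩ) (Ω.domRestrict '' {F : X → ℂ | IsLpHolomorphic p μ Ω F})
      (U.domRestrict '' {f : X → ℂ | IsLpHolomorphic p μ U f}) := by
  refine ⟨?_, ?_, ?_⟩
  · rintro _ ⟨F, hF, rfl⟩
    exact ⟨F, ⟨hF.1.mono hUΩ, hF.2.mono_measure (Measure.restrict_mono hUΩ le_rfl)⟩, rfl⟩
  · rintro _ ⟨F, hF, rfl⟩ _ ⟨G, hG, rfl⟩ hFG
    obtain ⟨z, hz⟩ := hUne
    exact domRestrict_eq_domRestrict_iff.2 (eqOn_of_isPreconnected_of_eventuallyEq hΩ hΩc hF.1 hG.1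
      (hUΩ hz) (mem_of_superset (hU.mem_nhds hz) fun y hy => congrFun hFG ⟨y, hy⟩))
  · rintro _ ⟨f, hf, rfl⟩
    obtain ⟨F, hF, hFf⟩ := hext f hf
    exact ⟨_, ⟨F, hF, rfl⟩, domRestrict_eq_domRestrict_iff.2 hFf⟩

variable [FiniteDimensional ℂ X] [MeasurableSpace X] [BorelSpace X] {μ : Measure X}
  [μ.IsAddHaarMeasure] {p : ℝ≥0∞} {r R : ℝ} {H : AffineSubspace ℝ X}

theorem exists_isLpHolomorphic_extension (hp : 1 ≤ p) (hp' : p ≠ ∞) (hΩ : IsOpen Ω)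
    (hE : IsClosed E) (hr : 0 < r) (hEr : cthickening r E ⊆ Ω)
    (hH : 3 ≤ finrank ℝ (X ⧸ H.direction)) (hEH : E ⊆ thickening R (H : Set X))
    (hc : IsPreconnected (Ω \ E)) {f : X → ℂ} (hf : IsLpHolomorphic p μ (Ω \ E) f) :
    ∃ F : X → ℂ, IsLpHolomorphic p μ Ω F ∧ EqOn F f (Ω \ E) := by
  rcases E.eq_empty_or_nonempty with rfl | hEne
  · exact ⟨f, by simpa using hf, fun _ _ => rfl⟩
  have : FiniteDimensional ℝ X := FiniteDimensional.complexToReal X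
  have hU : IsOpen (Ω \ E) := hΩ.sdiff hE
  obtain ⟨v, hv⟩ := exists_forall_smul_mem_imp_eq_zero (hH.trans' (by norm_num))
  obtain ⟨L, hL, hLH⟩ := exists_continuousLinearMap_smul_eq hv
  obtain ⟨ℓ, hℓ, hℓH, hℓv⟩ := exists_functional_vanishing hH v
  obtain ⟨χ, hχ, hχE, hχr, C, hC⟩ := exists_contDiff_cutoff E hr 2
  have hEχ : E ⊆ tsupport χ := fun z hz => subset_tsupport _ (by simp [(hχE z hz).eq_of_nhds])
  have hχΩ : tsupport χ ⊆ Ω := hχr.trans hEr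
  have htube : tsupport χ ⊆ thickening (r + 1 + R) (H : Set X) := hχr.trans <|
    (cthickening_subset_thickening' (by linarith) (lt_add_one r) E).trans <|
      (thickening_subset_of_subset _ hEH).trans (thickening_thickening_subset _ _ _)
  have hbdd {Y : Type} [NormedAddCommGroup Y] [NormedSpace ℝ Y] {T : X →L[ℝ] Y}
      (hT : H.direction ≤ T.ker) : Bornology.IsBounded (T '' tsupport χ) :=
    (isBounded_image_thickening hT _).subset (image_mono htube)
  obtain ⟨M, hM⟩ := (hbdd hLH).subset_closedBall 0
  have hχM : tsupport χ ⊆ L ⁻¹' closedBall 0 M := image_subset_iff.1 hM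
  have hdχM := (tsupport_fderiv_subset ℝ).trans hχM
  have hdχU := (tsupport_fderiv_subset_sdiff hχE).trans (sdiff_subset_sdiff_left hχΩ)
  have hext : EqOn (hartogsExtension v χ f) f (Ω \ E) :=
    eqOn_hartogsExtension_sdiff hL hχM hℓ hℓv (hbdd hℓH) hΩ hU hc hf.1 hχ hdχU hEne hEχ hχΩ
  refine ⟨hartogsExtension v χ f, ⟨fun z hz => ?_, ?_⟩, hext⟩
  · exact (differentiableAt_hartogsExtension hL hdχM hU hf.1 hχ hdχU
      ((em (z ∈ E)).symm.imp (⟨hz, ·⟩) (hχE z))).differentiableWithinAt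
  · have hLp := memLp_hartogsExtension hp hp' hL hdχM hU hf.1 hχ hdχU hC hE.measurableSet
      (hEχ.trans hχM) (fun z hz => (hχE z hz).eq_of_nhds) hext hf.2
    rwa [sdiff_union_of_subset (hEχ.trans hχΩ)] at hLp

end Extension

theorem theorem1p1_general {X : Type*} [NormedAddCommGroup X] [NormedSpace ℂ X]
    [FiniteDimensional ℂ X] [MeasurableSpace X] [BorelSpace X] {μ : Measure X}
    [μ.IsAddHaarMeasure] {p : ℝ≥0∞} (hp : 1 ≤ p) (hp' : p ≠ ∞) {Ω E : Set X} (hΩ : IsOpen Ω)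
    (hΩc : IsPreconnected Ω) (hE : IsClosed E) {r : ℝ} (hr : 0 < r) (hEr : cthickening r E ⊆ Ω)
    {H : AffineSubspace ℝ X} (hH : 3 ≤ finrank ℝ (X ⧸ H.direction)) {R : ℝ}
    (hEH : E ⊆ thickening R (H : Set X)) (hc : IsConnected (Ω \ E)) :
    (∀ f, IsLpHolomorphic p μ (Ω \ E) f →
      ∃ F, IsLpHolomorphic p μ Ω F ∧ EqOn F f (Ω \ E)) ∧
    BijOn (domRestrict₂ sdiff_subset) (Ω.domRestrict '' {F : X → ℂ | IsLpHolomorphic p μ Ω F})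
      ((Ω \ E).domRestrict '' {f : X → ℂ | IsLpHolomorphic p μ (Ω \ E) f}) :=
  have hext := fun f hf =>
    exists_isLpHolomorphic_extension (f := f) hp hp' hΩ hE hr hEr hH hEH hc.isPreconnected hf
  ⟨hext, bijOn_domRestrict_isLpHolomorphic hΩ hΩc (hΩ.sdiff hE) hc.nonempty sdiff_subset hext⟩

theorem theorem1p1 (n : ℕ) (hn : 2 ≤ n) (Ω E : Set (CSpace n))
    (hΩ_open : IsOpen Ω) (hΩ_conn : IsConnected Ω) (hE_closed : IsClosed E)
    (h1 : ∃ r : ℝ, 0 < r ∧ Metric.cthickening r E ⊆ Ω)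
    (h2 : ∃ (H : AffineSubspace ℝ (CSpace n)) (R : ℝ),
      (H : Set (CSpace n)).Nonempty ∧
      3 ≤ Module.finrank ℝ (CSpace n ⧸ H.direction) ∧
      0 < R ∧ E ⊆ Metric.thickening R (H : Set (CSpace n)))
    (h3 : IsConnected (Ω \ E)) :
    (∀ f : CSpace n → ℂ, IsL2Holomorphic (Ω \ E) f →
      ∃ F : CSpace n → ℂ, IsL2Holomorphic Ω F ∧ Set.EqOn F f (Ω \ E)) ∧
    Set.BijOn (restrictToDiff Ω E) (bergmanSpace Ω) (bergmanSpace (Ω \ E)) := by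
  obtain ⟨r, hr, hEr⟩ := h1
  obtain ⟨H, R, -, hH, -, hEH⟩ := h2
  exact theorem1p1_general (μ := volume) one_le_two ENNReal.ofNat_ne_top hΩ_open
    hΩ_conn.isPreconnected hE_closed hr hEr hH hEH h3
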